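/- Let $(M^m,g)$ and $(N^n,h=\langle\cdot,\cdot\rangle)$ be smooth Riemannian manifolds without boundary, and suppose that $N$ has non-positive sectional curvature. Let $\phi:M\to N$ be a smooth isometric immersion, i.e. $\langle d\phi(X),d\phi(Y)\rangle=g(X,Y)$ for all tangent vectors $X,Y$ of $M$ at the same point. Let $\nabla$ and $\nabla^N$ be the Levi-Civita connections of $M$ and $N$, $\nabla^\phi$ the connection on $\phi^{-1}TN$ induced by $\nabla^N$, $B(X,Y)=\nabla^\phi_X(d\phi(Y))-d\phi(\nabla_XY)$ the second fundamental form, and $${\bf H}=\frac1m\sum_{i=1}^m B(e_i,e_i)$$ the mean curvature vector field, where $\{e_i\}_{i=1}^m$ is a local orthonormal frame on $M$ (if $m=0$, ${\bf H}=0$). Write $\Delta^\phi=\sum_{i=1}^m(\nabla^\phi_{e_i}\nabla^\phi_{e_i}-\nabla^\phi_{\nabla_{e_i}e_i})$, $\Delta=\sum_{i=1}^m(e_ie_i-\nabla_{e_i}e_i)$ for the (non-positive) Laplace operator on functions on $M$, $R^N(X,Y)Z=[\nabla^N_X,\nabla^N_Y]Z-\nabla^N_{[X,Y]}Z$, and $[\,\cdot\,]^\perp$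 for the component orthogonal to $d\phi(TM)$. Suppose that $M$ is a non-negative biminimal submanifold of $N$, that is, for some real constant $\lambda\ge 0$, $$\Big[-\Delta^\phi{\bf H}-\sum_{i=1}^m R^N({\bf H},d\phi(e_i))d\phi(e_i)\Big]^\perp+\lambda{\bf H}=0\quad\text{on } M.$$ Then, at every point of $M$, $$\Delta|{\bf H}|^2\ \ge\ 2m\,|{\bf H}|^4 .$$ -/

import Mathlib

open Bundle
open scoped Manifold ContDiff

namespace RiemGeom

noncomputable section

/-! ## Riemannian geometry in a coordinate domain

A metric in coordinates is a map `g : E → E →L[ℝ] E →L[ℝ] ℝ`; the vectors `v w : E` are also used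
as constant vector fields (the coordinate fields and their linear combinations). -/

section Coordinates

variable {E F : Type*} [NormedAddCommGroup E] [NormedSpace ℝ E]
  [NormedAddCommGroup F] [NormedSpace ℝ F]

/-- The linear form `z ↦ (1/2) (∂_v g(w, z) + ∂_w g(v, z) - ∂_z g(v, w))` at the point `u`. -/
def koszulForm (g : E → E →L[ℝ] E →L[ℝ] ℝ) (u v w : E) : E →L[ℝ] ℝ :=
  (1 / 2 : ℝ) • (fderiv ℝ g u v w + fderiv ℝ g u w v - ((fderiv ℝ g u).flip v).flip w)

/-- The Christoffel symbol `Γ_u(v, w) = ∇_v w` of the Levi-Civita connection of `g`, that is, the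
vector with `g_u(Γ_u(v, w), z) = (1/2) (∂_v g(w, z) + ∂_w g(v, z) - ∂_z g(v, w))` for all `z`. -/
def christoffel (g : E → E →L[ℝ] E →L[ℝ] ℝ) (u v w : E) : E :=
  (g u).inverse (koszulForm g u v w)

/-- The Riemannian curvature `R(X, Y) Z = ∇_X ∇_Y Z - ∇_Y ∇_X Z - ∇_[X, Y] Z` of `g` at `u`,
computed with constant vector fields `X Y Z`. -/
def coordCurvature (g : E → E →L[ℝ] E →L[ℝ] ℝ) (u X Y Z : E) : E :=
  (fderiv ℝ (fun u' => christoffel g u' Y Z) u X + christoffel g u X (christoffel g u Y Z))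
    - (fderiv ℝ (fun u' => christoffel g u' X Z) u Y + christoffel g u Y (christoffel g u X Z))

/-- The covariant derivative `∇^f_v V` at `u` of a vector field `V` along the map `f : E → F`, for
the pull-back by `f` of the Levi-Civita connection of the metric `h` on the target. -/
def covAlong (h : F → F →L[ℝ] F →L[ℝ] ℝ) (f : E → F) (V : E → F) (u v : E) : F :=
  fderiv ℝ V u v + christoffel h (f u) (fderiv ℝ f u v) (V u)

/-- `∇^f_v (df(w)) - df(∇_v w)` at `u`, where `∇` is the Levi-Civita connection of `g`. -/
def coordSecondForm (g : E → E →L[ℝ] E →L[ℝ] ℝ) (h : F → F →L[ℝ] F →L[ℝ] ℝ) (f : E → F)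
    (u v w : E) : F :=
  covAlong h f (fun u' => fderiv ℝ f u' w) u v - fderiv ℝ f u (christoffel g u v w)

/-- The second covariant derivative `∇^f_v ∇^f_w V - ∇^f_(∇_v w) V` at `u` of a vector field `V`
along `f`. -/
def coordHessAlong (g : E → E →L[ℝ] E →L[ℝ] ℝ) (h : F → F →L[ℝ] F →L[ℝ] ℝ) (f : E → F)
    (V : E → F) (u v w : E) : F :=
  covAlong h f (fun u' => covAlong h f V u' w) u v - covAlong h f V u (christoffel g u v w)

/-- The Hessian `v(w(a)) - (∇_v w)(a)` at `u` of a real function `a`. -/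
def coordHess (g : E → E →L[ℝ] E →L[ℝ] ℝ) (a : E → ℝ) (u v w : E) : ℝ :=
  fderiv ℝ (fun u' => fderiv ℝ a u' w) u v - fderiv ℝ a u (christoffel g u v w)

end Coordinates

/-! ## Riemannian manifolds

`M` is a manifold without boundary modelled on `E`, with an inner product on each tangent space. -/

section Manifold

variable {E : Type*} [NormedAddCommGroup E] [NormedSpace ℝ E]
  {M : Type*} [TopologicalSpace M] [ChartedSpace E M] [IsManifold 𝓘(ℝ, E) ∞ M]

/-- The coordinates of tangent vectors at `y` in the chart around `x₀` (the differential at `y` of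
that chart, for `y` in its domain). -/
def toCoord (x₀ y : M) : TangentSpace 𝓘(ℝ, E) y →L[ℝ] E :=
  (trivializationAt E (TangentSpace 𝓘(ℝ, E)) x₀).continuousLinearMapAt ℝ y

/-- The tangent vectors at `y` with given coordinates in the chart around `x₀`: the inverse of
`toCoord x₀ y`, for `y` in the domain of that chart. -/
def ofCoord (x₀ y : M) : E →L[ℝ] TangentSpace 𝓘(ℝ, E) y :=
  (trivializationAt E (TangentSpace 𝓘(ℝ, E)) x₀).symmL ℝ y

variable [RiemannianBundle (fun x : M => TangentSpace 𝓘(ℝ, E) x)]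

/-- The Riemannian metric of `M` in the coordinates of the chart around `x₀`. -/
def coordMetric (x₀ : M) (u : E) : E →L[ℝ] E →L[ℝ] ℝ :=
  (innerSL ℝ).bilinearComp
    (ofCoord x₀ ((extChartAt 𝓘(ℝ, E) x₀).symm u)) (ofCoord x₀ ((extChartAt 𝓘(ℝ, E) x₀).symm u))

/-- The Riemannian curvature `R(X, Y) Z` of `M` at `x`, with the sign convention
`R(X, Y) Z = [∇_X, ∇_Y] Z - ∇_[X, Y] Z`. -/
def curvature (x : M) (X Y Z : TangentSpace 𝓘(ℝ, E) x) : TangentSpace 𝓘(ℝ, E) x :=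
  ofCoord x x (coordCurvature (coordMetric x) (extChartAt 𝓘(ℝ, E) x x)
    (toCoord x x X) (toCoord x x Y) (toCoord x x Z))

/-- The sectional curvature of the plane spanned by `X` and `Y` (meaningful if `X` and `Y` are
linearly independent). -/
def sectionalCurvature (x : M) (X Y : TangentSpace 𝓘(ℝ, E) x) : ℝ :=
  inner ℝ (curvature x X Y Y) X / (‖X‖ ^ 2 * ‖Y‖ ^ 2 - inner ℝ X Y ^ 2)

variable (E M) in
/-- All sectional curvatures of `M` are at most `0`. -/
def NonposSectionalCurvature : Prop :=
  ∀ (x : M) (X Y : TangentSpace 𝓘(ℝ, E) x), LinearIndependent ℝ ![X, Y] →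
    sectionalCurvature x X Y ≤ 0

variable [FiniteDimensional ℝ E]

instance finiteDimensional_tangentSpace (x : M) :
    FiniteDimensional ℝ (TangentSpace 𝓘(ℝ, E) x) :=
  inferInstanceAs (FiniteDimensional ℝ E)

/-- The metric trace `∑ i, β(e_i, e_i)`, where `(e_i)` is an orthonormal basis of the tangent space
at `x`; for bilinear `β` it does not depend on the basis. -/
def metricTrace {W : Type*} [AddCommGroup W] (x : M)
    (β : TangentSpace 𝓘(ℝ, E) x → TangentSpace 𝓘(ℝ, E) x → W) : W :=
  ∑ i, β (stdOrthonormalBasis ℝ (TangentSpace 𝓘(ℝ, E) x) i)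
    (stdOrthonormalBasis ℝ (TangentSpace 𝓘(ℝ, E) x) i)

variable (E) in
/-- The Laplace-Beltrami operator `Δ a = ∑ i, (e_i(e_i(a)) - (∇_(e_i) e_i)(a))`. -/
def laplacian (a : M → ℝ) (x : M) : ℝ :=
  metricTrace x fun v w =>
    coordHess (coordMetric x) (a ∘ (extChartAt 𝓘(ℝ, E) x).symm) (extChartAt 𝓘(ℝ, E) x x)
      (toCoord x x v) (toCoord x x w)

end Manifold

/-! ## Maps between Riemannian manifolds -/

section Maps

variable {E : Type*} [NormedAddCommGroup E] [NormedSpace ℝ E] [FiniteDimensional ℝ E]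
  {M : Type*} [TopologicalSpace M] [ChartedSpace E M] [IsManifold 𝓘(ℝ, E) ∞ M]
  [RiemannianBundle (fun x : M => TangentSpace 𝓘(ℝ, E) x)]
  {F : Type*} [NormedAddCommGroup F] [NormedSpace ℝ F] [FiniteDimensional ℝ F]
  {N : Type*} [TopologicalSpace N] [ChartedSpace F N] [IsManifold 𝓘(ℝ, F) ∞ N]
  [RiemannianBundle (fun y : N => TangentSpace 𝓘(ℝ, F) y)]

variable (E F) in
/-- `φ` is a (smooth) isometric immersion: its differential preserves inner products. -/
structure IsIsometricImmersion (φ : M → N) : Prop where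
  contMDiff : ContMDiff 𝓘(ℝ, E) 𝓘(ℝ, F) ∞ φ
  inner_mfderiv : ∀ (x : M) (v w : TangentSpace 𝓘(ℝ, E) x),
    inner ℝ (mfderiv 𝓘(ℝ, E) 𝓘(ℝ, F) φ x v) (mfderiv 𝓘(ℝ, E) 𝓘(ℝ, F) φ x w) = inner ℝ v w

/-- The map `φ` in the charts around `x` and `φ x`. -/
def coordMap (φ : M → N) (x : M) : E → F :=
  extChartAt 𝓘(ℝ, F) (φ x) ∘ φ ∘ (extChartAt 𝓘(ℝ, E) x).symm

/-- The vector field `V` along `φ` in the charts around `x` and `φ x`. -/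
def coordField (φ : M → N) (V : ∀ y : M, TangentSpace 𝓘(ℝ, F) (φ y)) (x : M) (u : E) : F :=
  toCoord (φ x) (φ ((extChartAt 𝓘(ℝ, E) x).symm u)) (V ((extChartAt 𝓘(ℝ, E) x).symm u))

variable (E F) in
/-- The second fundamental form given by the Gauss formula:
`B(X, Y) = ∇^N_X Y - ∇_X Y`, that is, `∇^φ_X (dφ(Y)) - dφ(∇_X Y)`. -/
def secondFundamentalForm (φ : M → N) (x : M) (v w : TangentSpace 𝓘(ℝ, E) x) :
    TangentSpace 𝓘(ℝ, F) (φ x) :=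
  ofCoord (φ x) (φ x) (coordSecondForm (coordMetric x) (coordMetric (φ x)) (coordMap φ x)
    (extChartAt 𝓘(ℝ, E) x x) (toCoord x x v) (toCoord x x w))

variable (E F) in
/-- The mean curvature vector field `H = (1/m) ∑ i, B(e_i, e_i)`, where `m = dim M`. -/
def meanCurvature (φ : M → N) (x : M) : TangentSpace 𝓘(ℝ, F) (φ x) :=
  (Module.finrank ℝ E : ℝ)⁻¹ • metricTrace x (secondFundamentalForm E F φ x)

variable (E) in
/-- The rough Laplacian `Δ^φ V = ∑ i, (∇^φ_(e_i) ∇^φ_(e_i) V - ∇^φ_(∇_(e_i) e_i) V)` of a vector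
field `V` along `φ`. -/
def roughLaplacian (φ : M → N) (V : ∀ y : M, TangentSpace 𝓘(ℝ, F) (φ y)) (x : M) :
    TangentSpace 𝓘(ℝ, F) (φ x) :=
  metricTrace x fun v w =>
    ofCoord (φ x) (φ x) (coordHessAlong (coordMetric x) (coordMetric (φ x)) (coordMap φ x)
      (coordField φ V x) (extChartAt 𝓘(ℝ, E) x x) (toCoord x x v) (toCoord x x w))

variable (E) in
/-- The component of `W` orthogonal to the image of the differential of `φ`. -/
def normalPart (φ : M → N) (x : M) (W : TangentSpace 𝓘(ℝ, F) (φ x)) :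
    TangentSpace 𝓘(ℝ, F) (φ x) :=
  W - (LinearMap.range (mfderiv 𝓘(ℝ, E) 𝓘(ℝ, F) φ x).toLinearMap).starProjection W

variable (E F) in
/-- The isometric immersion `φ` makes `M` a biminimal submanifold with constant `lam`:
`[-Δ^φ H - ∑ i, R^N(H, dφ(e_i)) dφ(e_i)]^⊥ + lam H = 0` at every point. -/
structure IsBiminimalSubmanifold (φ : M → N) (lam : ℝ) : Prop where
  isometric : IsIsometricImmersion E F φ
  equation : ∀ x : M,
    normalPart E φ x (-roughLaplacian E φ (meanCurvature E F φ) x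
      - metricTrace x (fun v w => curvature (φ x) (meanCurvature E F φ x)
          (mfderiv 𝓘(ℝ, E) 𝓘(ℝ, F) φ x v) (mfderiv 𝓘(ℝ, E) 𝓘(ℝ, F) φ x w)))
      + lam • meanCurvature E F φ x = 0

end Maps

end

end RiemGeom

/-!
Write `H` for the mean curvature vector field and `∇H` for its derivative along `φ`. The Bochner
formula for fields along `φ` gives `Δ|H|² = 2⟨Δ^φ H, H⟩ + 2|∇H|²`. As `H` is normal, pairing the
biminimal equation with `H` gives `⟨Δ^φ H, H⟩ = λ|H|² - ∑ᵢ ⟨R^N(H, dφ(eᵢ))dφ(eᵢ), H⟩ ≥ λ|H|²`.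
Differentiating `⟨H, dφ(Y)⟩ = 0` along `X` gives `⟨∇_X H, dφ(Y)⟩ = -⟨H, B(X, Y)⟩`, hence
`|∇H|² ≥ ∑ᵢ ⟨H, B(eᵢ, eᵢ)⟩² ≥ m⁻¹(∑ᵢ ⟨H, B(eᵢ, eᵢ)⟩)² = m|H|⁴`.

The value of `H` at a point is defined in the charts centred at that point. That `H` is smooth in a
fixed chart follows from the chart independence of `B`: a change of coordinates is a local isometry,
and the second fundamental form of a local isometry vanishes.
-/

namespace RiemGeom

open Filter Topology
open scoped RealInnerProductSpace

/-! ### The Levi-Civita connection in coordinates -/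

section Coordinates

variable {E F G : Type*} [NormedAddCommGroup E] [NormedSpace ℝ E]
  [NormedAddCommGroup F] [NormedSpace ℝ F] [NormedAddCommGroup G] [NormedSpace ℝ G]

-- Instance search in these spaces otherwise runs into the costly instances for Riemannian bundles.

noncomputable local instance : NormedAddCommGroup (E →L[ℝ] F →L[ℝ] G) :=
  ContinuousLinearMap.toNormedAddCommGroup

noncomputable local instance : NormedSpace ℝ (E →L[ℝ] F →L[ℝ] G) :=
  ContinuousLinearMap.toNormedSpace

noncomputable local instance {H : Type*} [NormedAddCommGroup H] [NormedSpace ℝ H] :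
    NormedAddCommGroup (E →L[ℝ] F →L[ℝ] G →L[ℝ] H) :=
  ContinuousLinearMap.toNormedAddCommGroup

noncomputable local instance {H : Type*} [NormedAddCommGroup H] [NormedSpace ℝ H] :
    NormedSpace ℝ (E →L[ℝ] F →L[ℝ] G →L[ℝ] H) :=
  ContinuousLinearMap.toNormedSpace

variable {g : E → E →L[ℝ] E →L[ℝ] ℝ} {h : F → F →L[ℝ] F →L[ℝ] ℝ} {k : G → G →L[ℝ] G →L[ℝ] ℝ}
  {f : E → F} {u : E}

section Calculus

lemma eventually_differentiableAt (hf : ContDiffAt ℝ 1 f u) :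
    ∀ᶠ u' in 𝓝 u, DifferentiableAt ℝ f u' :=
  (hf.eventually (by simp)).mono fun _ hf' => hf'.differentiableAt one_ne_zero

lemma differentiableAt_fderiv (hf : ContDiffAt ℝ 2 f u) : DifferentiableAt ℝ (fderiv ℝ f) u :=
  (hf.fderiv_right (m := 1) (by norm_num)).differentiableAt one_ne_zero

lemma fderiv_apply_const {L : E → F →L[ℝ] G} (hL : DifferentiableAt ℝ L u) (v : E) (w : F) :
    fderiv ℝ (fun u' => L u' w) u v = fderiv ℝ L u v w := by
  rw [fderiv_clm_apply hL (differentiableAt_const w)]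
  simp

lemma fderiv_fderiv_comm (hf : ContDiffAt ℝ 2 f u) (v w : E) :
    fderiv ℝ (fderiv ℝ f) u v w = fderiv ℝ (fderiv ℝ f) u w v :=
  (hf.isSymmSndFDerivAt (by simp)).eq v w

lemma fderiv_fderiv_comp {f₂ : F → G} (hf₂ : ContDiffAt ℝ 2 f₂ (f u)) (hf : ContDiffAt ℝ 2 f u)
    (v w : E) :
    fderiv ℝ (fderiv ℝ (f₂ ∘ f)) u v w =
      fderiv ℝ (fderiv ℝ f₂) (f u) (fderiv ℝ f u v) (fderiv ℝ f u w)
        + fderiv ℝ f₂ (f u) (fderiv ℝ (fderiv ℝ f) u v w) := by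
  have hd : DifferentiableAt ℝ f u := hf.differentiableAt two_ne_zero
  have hchain : fderiv ℝ (f₂ ∘ f) =ᶠ[𝓝 u] fun u' => (fderiv ℝ f₂ (f u')).comp (fderiv ℝ f u') := by
    filter_upwards [eventually_differentiableAt (hf.of_le one_le_two),
      hd.continuousAt.eventually (eventually_differentiableAt (hf₂.of_le one_le_two))]
      with u' hu' hfu'
    exact fderiv_comp u' hfu' hu'
  have hc : DifferentiableAt ℝ (fderiv ℝ f₂ ∘ f) u := (differentiableAt_fderiv hf₂).comp u hd
  have hprod := fderiv_clm_comp hc (differentiableAt_fderiv hf)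
  rw [fderiv_comp u (differentiableAt_fderiv hf₂) hd] at hprod
  rw [hchain.fderiv_eq]
  simp only [Function.comp_apply] at hprod
  rw [hprod]
  simp [add_comm]

lemma fderiv_bilinear_comp {V W : E → F} (hh : DifferentiableAt ℝ h (f u))
    (hf : DifferentiableAt ℝ f u) (hV : DifferentiableAt ℝ V u) (hW : DifferentiableAt ℝ W u)
    (z : E) :
    fderiv ℝ (fun u' => h (f u') (V u') (W u')) u z =
      fderiv ℝ h (f u) (fderiv ℝ f u z) (V u) (W u) + h (f u) (fderiv ℝ V u z) (W u)
        + h (f u) (V u) (fderiv ℝ W u z) := by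
  have hc : DifferentiableAt ℝ (h ∘ f) u := hh.comp u hf
  have hprod := fderiv_clm_apply (hc.clm_apply hV) hW
  rw [fderiv_clm_apply hc hV, fderiv_comp u hh hf] at hprod
  simp only [Function.comp_apply] at hprod
  rw [hprod]
  simp only [add_apply, ContinuousLinearMap.comp_apply, ContinuousLinearMap.flip_apply]
  ring

end Calculus

lemma koszulForm_apply (g : E → E →L[ℝ] E →L[ℝ] ℝ) (u v w z : E) :
    koszulForm g u v w z =
      1 / 2 * (fderiv ℝ g u v w z + fderiv ℝ g u w v z - fderiv ℝ g u z v w) := by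
  simp [koszulForm]

/-- `christoffel g u` as a bilinear map. -/
noncomputable def christoffelBilin (g : E → E →L[ℝ] E →L[ℝ] ℝ) (u : E) : E →ₗ[ℝ] E →ₗ[ℝ] E :=
  (LinearMap.mk₂ ℝ (koszulForm g u)
    (fun v v' w => by ext z; simp only [koszulForm_apply, add_apply, map_add]; ring)
    (fun c v w => by ext z; simp only [koszulForm_apply, smul_apply, map_smul, smul_eq_mul]; ring)
    (fun v w w' => by ext z; simp only [koszulForm_apply, add_apply, map_add]; ring)
    (fun c v w => by
      ext z; simp only [koszulForm_apply, smul_apply, map_smul, smul_eq_mul]; ring)).compr₂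
    (g u).inverse.toLinearMap

lemma christoffelBilin_apply (g : E → E →L[ℝ] E →L[ℝ] ℝ) (u v w : E) :
    christoffelBilin g u v w = christoffel g u v w := rfl

lemma coordCurvature_zero_right (g : E → E →L[ℝ] E →L[ℝ] ℝ) (u X Y : E) :
    coordCurvature g u X Y 0 = 0 := by
  simp [coordCurvature, ← christoffelBilin_apply]

/-- `g` is a smooth field of nondegenerate bilinear forms around `u`, symmetric near `u`: a
pseudo-Riemannian metric in coordinates. -/
structure IsMetricAt (g : E → E →L[ℝ] E →L[ℝ] ℝ) (u : E) : Prop where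
  contDiffAt : ContDiffAt ℝ ∞ g u
  symm : ∀ᶠ u' in 𝓝 u, ∀ v w, g u' v w = g u' w v
  isInvertible : (g u).IsInvertible

namespace IsMetricAt

lemma differentiableAt (hg : IsMetricAt g u) : DifferentiableAt ℝ g u :=
  hg.contDiffAt.differentiableAt (by simp)

lemma apply_comm (hg : IsMetricAt g u) (v w : E) : g u v w = g u w v :=
  hg.symm.self_of_nhds v w

lemma eq_zero_of_forall_apply_eq_zero (hg : IsMetricAt g u) {a : E} (ha : ∀ z, g u a z = 0) :
    a = 0 :=
  hg.isInvertible.injective (by ext z; simp [ha])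

lemma apply_christoffel (hg : IsMetricAt g u) (v w : E) :
    g u (christoffel g u v w) = koszulForm g u v w :=
  hg.isInvertible.self_apply_inverse _

lemma fderiv_apply (hg : IsMetricAt g u) (z v w : E) :
    fderiv ℝ (fun u' => g u' v w) u z = fderiv ℝ g u z v w := by
  rw [fderiv_apply_const (hg.differentiableAt.clm_apply (differentiableAt_const v)),
    fderiv_apply_const hg.differentiableAt]

lemma fderiv_comm (hg : IsMetricAt g u) (z v w : E) :
    fderiv ℝ g u z v w = fderiv ℝ g u z w v := by
  have hvw : (fun u' => g u' v w) =ᶠ[𝓝 u] fun u' => g u' w v := hg.symm.mono fun _ hu' => hu' v w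
  rw [← hg.fderiv_apply, hvw.fderiv_eq, hg.fderiv_apply]

lemma christoffel_comm (hg : IsMetricAt g u) (v w : E) :
    christoffel g u v w = christoffel g u w v := by
  have : koszulForm g u v w = koszulForm g u w v := by
    ext z
    rw [koszulForm_apply, koszulForm_apply, hg.fderiv_comm z v w]
    ring
  rw [christoffel, this, christoffel]

lemma fderiv_eq_christoffel (hg : IsMetricAt g u) (z v w : E) :
    fderiv ℝ g u z v w = g u (christoffel g u z v) w + g u v (christoffel g u z w) := by
  rw [hg.apply_comm v, hg.apply_christoffel, hg.apply_christoffel, koszulForm_apply,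
    koszulForm_apply, hg.fderiv_comm z w v, hg.fderiv_comm v z w, hg.fderiv_comm w z v]
  ring

lemma fderiv_apply_covAlong {V W : E → F} (hh : IsMetricAt h (f u))
    (hf : DifferentiableAt ℝ f u) (hV : DifferentiableAt ℝ V u) (hW : DifferentiableAt ℝ W u)
    (z : E) :
    fderiv ℝ (fun u' => h (f u') (V u') (W u')) u z =
      h (f u) (covAlong h f V u z) (W u) + h (f u) (V u) (covAlong h f W u z) := by
  rw [fderiv_bilinear_comp hh.differentiableAt hf hV hW, hh.fderiv_eq_christoffel]
  simp only [covAlong, map_add, add_apply]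
  ring

section Smoothness

variable [CompleteSpace F] {n : ℕ∞}

lemma contDiffAt_inverse (hh : IsMetricAt h (f u)) (hf : ContDiffAt ℝ n f u) :
    ContDiffAt ℝ n (fun u' => (h (f u')).inverse) u :=
  ContDiffAt.comp u (g := ContinuousLinearMap.inverse)
    (ContinuousLinearMap.IsInvertible.contDiffAt_map_inverse hh.isInvertible)
    ((hh.contDiffAt.of_le (by exact_mod_cast le_top)).comp u hf)

lemma contDiffAt_christoffel {V W : E → F} (hh : IsMetricAt h (f u))
    (hf : ContDiffAt ℝ n f u) (hV : ContDiffAt ℝ n V u) (hW : ContDiffAt ℝ n W u) :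
    ContDiffAt ℝ n (fun u' => christoffel h (f u') (V u') (W u')) u := by
  have hD : ContDiffAt ℝ n (fun u' => fderiv ℝ h (f u')) u :=
    (hh.contDiffAt.fderiv_right (m := n) (by exact_mod_cast le_top)).comp u hf
  have hDflip : ContDiffAt ℝ n (fun u' => (fderiv ℝ h (f u')).flip) u :=
    (ContinuousLinearMap.flipₗᵢ ℝ F F (F →L[ℝ] ℝ)).contDiff.contDiffAt.comp u hD
  have hDV : ContDiffAt ℝ n (fun u' => ((fderiv ℝ h (f u')).flip (V u')).flip) u :=
    (ContinuousLinearMap.flipₗᵢ ℝ F F ℝ).contDiff.contDiffAt.comp u (hDflip.clm_apply hV)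
  unfold christoffel koszulForm
  exact (hh.contDiffAt_inverse hf).clm_apply (contDiffAt_const.fun_smul
    ((((hD.clm_apply hV).clm_apply hW).add ((hD.clm_apply hW).clm_apply hV)).sub
      (hDV.clm_apply hW)))

lemma contDiffAt_covAlong {V : E → F} (hh : IsMetricAt h (f u))
    (hf : ContDiffAt ℝ (n + 1) f u) (hV : ContDiffAt ℝ (n + 1) V u) (w : E) :
    ContDiffAt ℝ n (fun u' => covAlong h f V u' w) u :=
  ((hV.fderiv_right le_rfl).clm_apply contDiffAt_const).add
    (hh.contDiffAt_christoffel (hf.of_le le_self_add)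
      ((hf.fderiv_right le_rfl).clm_apply contDiffAt_const) (hV.of_le le_self_add))

end Smoothness

end IsMetricAt

lemma covAlong_const_smul {V : E → F} (hV : DifferentiableAt ℝ V u) (c : ℝ) (v : E) :
    covAlong h f (fun u' => c • V u') u v = c • covAlong h f V u v := by
  rw [covAlong, covAlong, fderiv_fun_const_smul hV, ← christoffelBilin_apply, map_smul, smul_add]
  rfl

lemma coordHess_congr {a a' : E → ℝ} (ha : a =ᶠ[𝓝 u] a') (v w : E) :
    coordHess g a u v w = coordHess g a' u v w := by
  have hw : (fun u' => fderiv ℝ a u' w) =ᶠ[𝓝 u] fun u' => fderiv ℝ a' u' w :=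
    (ha.fderiv (𝕜 := ℝ)).mono fun _ hu' => congrArg (· w) hu'
  rw [coordHess, coordHess, hw.fderiv_eq, ha.fderiv_eq]

lemma coordHess_metric_self [CompleteSpace F] {V : E → F}
    (hh : ∀ᶠ u' in 𝓝 u, IsMetricAt h (f u')) (hf : ContDiffAt ℝ 2 f u) (hV : ContDiffAt ℝ 2 V u)
    (v : E) :
    coordHess g (fun u' => h (f u') (V u') (V u')) u v v =
      2 * h (f u) (coordHessAlong g h f V u v v) (V u)
        + 2 * h (f u) (covAlong h f V u v) (covAlong h f V u v) := by
  have hh₀ := hh.self_of_nhds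
  have hfd := eventually_differentiableAt (hf.of_le one_le_two)
  have hVd := eventually_differentiableAt (hV.of_le one_le_two)
  have hgrad (w : E) : (fun u' => fderiv ℝ (fun u' => h (f u') (V u') (V u')) u' w) =ᶠ[𝓝 u]
      fun u' => h (f u') ((2 : ℝ) • covAlong h f V u' w) (V u') := by
    filter_upwards [hh, hfd, hVd] with u' hh' hf' hV'
    rw [hh'.fderiv_apply_covAlong hf' hV' hV', hh'.apply_comm (V u')]
    simp [two_mul]
  have hcov : DifferentiableAt ℝ (fun u' => covAlong h f V u' v) u :=
    (hh₀.contDiffAt_covAlong (n := 1) (by simpa [one_add_one_eq_two] using hf)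
      (by simpa [one_add_one_eq_two] using hV) v).differentiableAt one_ne_zero
  rw [coordHess, (hgrad v).fderiv_eq, (hgrad _).eq_of_nhds,
    hh₀.fderiv_apply_covAlong hfd.self_of_nhds (hcov.fun_const_smul _) hVd.self_of_nhds,
    covAlong_const_smul hcov, coordHessAlong]
  simp only [map_smul, smul_apply, map_sub, sub_apply, smul_eq_mul]
  ring

/-! ### The second fundamental form in coordinates -/

lemma coordSecondForm_eq (hf : ContDiffAt ℝ 2 f u) (v w : E) :
    coordSecondForm g h f u v w = fderiv ℝ (fderiv ℝ f) u v w
      + christoffel h (f u) (fderiv ℝ f u v) (fderiv ℝ f u w)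
      - fderiv ℝ f u (christoffel g u v w) := by
  rw [coordSecondForm, covAlong, fderiv_apply_const (differentiableAt_fderiv hf)]

/-- `coordSecondForm g h f u` as a bilinear map; the two agree where `f` is `C²`. -/
noncomputable def secondFormBilin (g : E → E →L[ℝ] E →L[ℝ] ℝ) (h : F → F →L[ℝ] F →L[ℝ] ℝ)
    (f : E → F) (u : E) : E →ₗ[ℝ] E →ₗ[ℝ] F :=
  (fderiv ℝ (fderiv ℝ f) u).toLinearMap₁₂
    + (christoffelBilin h (f u)).compl₁₂ (fderiv ℝ f u).toLinearMap (fderiv ℝ f u).toLinearMap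
    - (christoffelBilin g u).compr₂ (fderiv ℝ f u).toLinearMap

lemma secondFormBilin_apply (hf : ContDiffAt ℝ 2 f u) (v w : E) :
    secondFormBilin g h f u v w = coordSecondForm g h f u v w :=
  (coordSecondForm_eq hf v w).symm

lemma coordSecondForm_comm (hg : IsMetricAt g u) (hh : IsMetricAt h (f u))
    (hf : ContDiffAt ℝ 2 f u) (v w : E) :
    coordSecondForm g h f u v w = coordSecondForm g h f u w v := by
  rw [coordSecondForm_eq hf, coordSecondForm_eq hf, fderiv_fderiv_comm hf,
    hh.christoffel_comm, hg.christoffel_comm]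

lemma coordSecondForm_congr {f' : E → F} (hff' : f =ᶠ[𝓝 u] f') (v w : E) :
    coordSecondForm g h f u v w = coordSecondForm g h f' u v w := by
  have hw : (fun u' => fderiv ℝ f u' w) =ᶠ[𝓝 u] fun u' => fderiv ℝ f' u' w :=
    (hff'.fderiv (𝕜 := ℝ)).mono fun _ hu' => congrArg (· w) hu'
  rw [coordSecondForm, coordSecondForm, covAlong, covAlong, hw.fderiv_eq, hff'.fderiv_eq,
    hff'.eq_of_nhds]

lemma coordSecondForm_comp {f₂ : F → G} (hf₂ : ContDiffAt ℝ 2 f₂ (f u)) (hf : ContDiffAt ℝ 2 f u)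
    (v w : E) :
    coordSecondForm g k (f₂ ∘ f) u v w =
      coordSecondForm h k f₂ (f u) (fderiv ℝ f u v) (fderiv ℝ f u w)
        + fderiv ℝ f₂ (f u) (coordSecondForm g h f u v w) := by
  rw [coordSecondForm_eq (hf₂.comp u hf), coordSecondForm_eq hf, coordSecondForm_eq hf₂,
    fderiv_fderiv_comp hf₂ hf,
    fderiv_comp u (hf₂.differentiableAt two_ne_zero) (hf.differentiableAt two_ne_zero)]
  simp only [Function.comp_apply, ContinuousLinearMap.comp_apply, map_add, map_sub]
  abel

lemma contDiffAt_coordSecondForm [CompleteSpace E] [CompleteSpace F] {n : ℕ∞}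
    (hg : IsMetricAt g u) (hh : IsMetricAt h (f u)) (hf : ContDiffAt ℝ (n + 2) f u) (v w : E) :
    ContDiffAt ℝ n (fun u' => coordSecondForm g h f u' v w) u := by
  have hn : (n + 1 + 1 : ℕ∞ω) = n + 2 := by rw [add_assoc, one_add_one_eq_two]
  have hf₁ : ContDiffAt ℝ (n + 1) f u := hf.of_le (hn ▸ le_self_add)
  exact (hh.contDiffAt_covAlong hf₁
    ((hf.fderiv_right hn.le).clm_apply contDiffAt_const) v).sub
    ((hf₁.fderiv_right le_rfl).clm_apply
      (hg.contDiffAt_christoffel (f := id) contDiffAt_id contDiffAt_const contDiffAt_const))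

section Isometry

variable (hg : IsMetricAt g u) (hh : IsMetricAt h (f u)) (hf : ContDiffAt ℝ 2 f u)
  (hiso : ∀ᶠ u' in 𝓝 u, ∀ v w, g u' v w = h (f u') (fderiv ℝ f u' v) (fderiv ℝ f u' w))
include hg hh hf hiso

lemma metric_coordSecondForm_antisymm (v w z : E) :
    h (f u) (coordSecondForm g h f u v w) (fderiv ℝ f u z) =
      - h (f u) (coordSecondForm g h f u v z) (fderiv ℝ f u w) := by
  have hdf (a : E) : DifferentiableAt ℝ (fun u' => fderiv ℝ f u' a) u :=
    (differentiableAt_fderiv hf).clm_apply (differentiableAt_const a)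
  have hpull : (fun u' => g u' w z) =ᶠ[𝓝 u]
      fun u' => h (f u') (fderiv ℝ f u' w) (fderiv ℝ f u' z) := hiso.mono fun _ hu' => hu' w z
  have hderiv := hpull.fderiv_eq (𝕜 := ℝ)
  have hv := congrArg (· v) hderiv
  simp only [hg.fderiv_apply, hg.fderiv_eq_christoffel,
    hh.fderiv_apply_covAlong (hf.differentiableAt two_ne_zero) (hdf w) (hdf z),
    hiso.self_of_nhds] at hv
  simp only [coordSecondForm, map_sub, sub_apply]
  rw [hh.apply_comm (covAlong h f (fun u' => fderiv ℝ f u' z) u v),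
    hh.apply_comm (fderiv ℝ f u (christoffel g u v z))]
  linarith

/-- A trilinear form that is symmetric in its first two and antisymmetric in its last two arguments
vanishes. -/
lemma metric_coordSecondForm_fderiv (v w z : E) :
    h (f u) (coordSecondForm g h f u v w) (fderiv ℝ f u z) = 0 := by
  have hanti := metric_coordSecondForm_antisymm hg hh hf hiso
  have hsymm := coordSecondForm_comm hg hh hf
  have hneg : h (f u) (coordSecondForm g h f u v w) (fderiv ℝ f u z) =
      - h (f u) (coordSecondForm g h f u v w) (fderiv ℝ f u z) := by
    conv_lhs => rw [hanti, hsymm, hanti, hsymm, hanti, hsymm, neg_neg]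
  linarith

lemma coordSecondForm_eq_zero (hsurj : Function.Surjective (fderiv ℝ f u)) (v w : E) :
    coordSecondForm g h f u v w = 0 :=
  hh.eq_zero_of_forall_apply_eq_zero <| hsurj.forall.2 fun z =>
    metric_coordSecondForm_fderiv hg hh hf hiso v w z

end Isometry

lemma metric_covAlong_fderiv {V : E → F} (hh : IsMetricAt h (f u))
    (hf : ContDiffAt ℝ 2 f u) (hV : DifferentiableAt ℝ V u)
    (hnormal : ∀ᶠ u' in 𝓝 u, ∀ w, h (f u') (V u') (fderiv ℝ f u' w) = 0) (v w : E) :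
    h (f u) (covAlong h f V u v) (fderiv ℝ f u w) =
      - h (f u) (V u) (coordSecondForm g h f u v w) := by
  have hzero : (fun u' => h (f u') (V u') (fderiv ℝ f u' w)) =ᶠ[𝓝 u] fun _ => 0 :=
    hnormal.mono fun _ hu' => hu' w
  have hderiv := hh.fderiv_apply_covAlong (hf.differentiableAt two_ne_zero) hV
    ((differentiableAt_fderiv hf).clm_apply (differentiableAt_const w)) v
  rw [hzero.fderiv_eq, fderiv_const_apply, zero_apply] at hderiv
  rw [coordSecondForm, map_sub, hnormal.self_of_nhds]
  linarith

end Coordinates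

section MetricTrace

variable {E W : Type*} [NormedAddCommGroup E] [NormedSpace ℝ E] [FiniteDimensional ℝ E]
  [AddCommGroup W] [Module ℝ W] {ι κ : Type*} [Fintype ι] {G : E →L[ℝ] E →L[ℝ] ℝ}

/-- The coefficient `G^{jk}` of the inverse matrix of the bilinear form `G` in the basis `b`. -/
noncomputable def inverseCoeff (G : E →L[ℝ] E →L[ℝ] ℝ) (b : Module.Basis κ ℝ E) (j k : κ) : ℝ :=
  b.coord k (G.inverse (b.coord j).toContinuousLinearMap)

lemma inverseCoeff_eq_sum (hG : G.IsInvertible) (b : Module.Basis κ ℝ E) {ε : ι → E}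
    (hε : ∀ w, ∑ i, G w (ε i) • ε i = w) (j k : κ) :
    inverseCoeff G b j k = ∑ i, b.coord j (ε i) * b.coord k (ε i) := by
  rw [inverseCoeff, ← hε (G.inverse _), map_sum, hG.self_apply_inverse]
  simp

lemma sum_apply_self_eq_sum_inverseCoeff_smul [Fintype κ] (hG : G.IsInvertible)
    (b : Module.Basis κ ℝ E) {ε : ι → E} (hε : ∀ w, ∑ i, G w (ε i) • ε i = w)
    (β : E →ₗ[ℝ] E →ₗ[ℝ] W) :
    ∑ i, β (ε i) (ε i) = ∑ j, ∑ k, inverseCoeff G b j k • β (b j) (b k) := by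
  have hexpand (i : ι) : β (ε i) (ε i) =
      ∑ j, ∑ k, (b.coord j (ε i) * b.coord k (ε i)) • β (b j) (b k) := by
    conv_lhs => rw [← b.sum_repr (ε i)]
    simp only [map_sum, LinearMap.sum_apply, map_smul, LinearMap.smul_apply, Finset.smul_sum,
      smul_smul, Module.Basis.coord_apply]
    rw [Finset.sum_comm]
    simp only [mul_comm]
  simp only [hexpand, inverseCoeff_eq_sum hG b hε, Finset.sum_smul]
  rw [Finset.sum_comm]
  exact Finset.sum_congr rfl fun j _ => Finset.sum_comm

lemma IsMetricAt.contDiffAt_inverseCoeff {g : E → E →L[ℝ] E →L[ℝ] ℝ} {u : E} (hg : IsMetricAt g u)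
    (b : Module.Basis κ ℝ E) (j k : κ) :
    ContDiffAt ℝ ∞ (fun u' => inverseCoeff (g u') b j k) u :=
  (b.coord k).toContinuousLinearMap.contDiff.contDiffAt.comp u <|
    (hg.contDiffAt_inverse (f := id) contDiffAt_id).clm_apply contDiffAt_const

end MetricTrace

/-! ### Charts -/

section Charts

variable {E : Type*} [NormedAddCommGroup E] [NormedSpace ℝ E]
  {M : Type*} [TopologicalSpace M] [ChartedSpace E M] {a z : M}

lemma extChartAt_symm_extChartAt (hz : z ∈ (chartAt E a).source) :
    (extChartAt 𝓘(ℝ, E) a).symm (extChartAt 𝓘(ℝ, E) a z) = z :=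
  (chartAt E a).extend_left_inv hz

lemma eventually_nhds_extChartAt_iff (hz : z ∈ (chartAt E a).source) {p : E → Prop} :
    (∀ᶠ u in 𝓝 (extChartAt 𝓘(ℝ, E) a z), p u) ↔ ∀ᶠ y in 𝓝 z, p (extChartAt 𝓘(ℝ, E) a y) := by
  rw [extChartAt, ← (chartAt E a).map_extend_nhds_of_boundaryless hz, eventually_map]

lemma eventually_of_forall_extChartAt {F N : Type*} [TopologicalSpace F] [TopologicalSpace N]
    [ChartedSpace F N] {φ : M → N} {b : N} {p : E → Prop} (hφ : ContinuousAt φ z)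
    (hz : z ∈ (chartAt E a).source) (hb : φ z ∈ (chartAt F b).source)
    (hp : ∀ y ∈ (chartAt E a).source, φ y ∈ (chartAt F b).source → p (extChartAt 𝓘(ℝ, E) a y)) :
    ∀ᶠ u in 𝓝 (extChartAt 𝓘(ℝ, E) a z), p u := by
  refine (eventually_nhds_extChartAt_iff hz).2 ?_
  filter_upwards [(chartAt E a).open_source.eventually_mem hz,
    hφ.eventually ((chartAt F b).open_source.eventually_mem hb)] with y hy hby
  exact hp y hy hby

variable [IsManifold 𝓘(ℝ, E) ∞ M]

lemma toCoord_ofCoord (hz : z ∈ (chartAt E a).source) (v : E) :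
    toCoord a z (ofCoord a z v) = v :=
  (trivializationAt E (TangentSpace 𝓘(ℝ, E)) a).continuousLinearMapAt_symmL (R := ℝ)
    (by simpa using hz) v

lemma ofCoord_toCoord (hz : z ∈ (chartAt E a).source) (v : TangentSpace 𝓘(ℝ, E) z) :
    ofCoord a z (toCoord a z v) = v :=
  (trivializationAt E (TangentSpace 𝓘(ℝ, E)) a).symmL_continuousLinearMapAt (R := ℝ)
    (by simpa using hz) v

lemma contMDiffAt_extChartAt_symm (hz : z ∈ (chartAt E a).source) :
    ContMDiffAt 𝓘(ℝ, E) 𝓘(ℝ, E) ∞ (extChartAt 𝓘(ℝ, E) a).symm (extChartAt 𝓘(ℝ, E) a z) :=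
  (contMDiffOn_extChartAt_symm a).contMDiffAt <| (isOpen_extChartAt_target a).mem_nhds <|
    (extChartAt 𝓘(ℝ, E) a).map_source (by simpa using hz)

lemma contMDiffAt_ofCoord (hz : z ∈ (chartAt E a).source) (v : E) :
    ContMDiffAt 𝓘(ℝ, E) (𝓘(ℝ, E).prod 𝓘(ℝ, E)) ∞
      (fun u => (⟨(extChartAt 𝓘(ℝ, E) a).symm u, ofCoord a ((extChartAt 𝓘(ℝ, E) a).symm u) v⟩ :
        TotalSpace E (TangentSpace 𝓘(ℝ, E) : M → Type _))) (extChartAt 𝓘(ℝ, E) a z) := by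
  let e := trivializationAt E (TangentSpace 𝓘(ℝ, E) : M → Type _) a
  have hbase {y : M} (hy : y ∈ (chartAt E a).source) : y ∈ e.baseSet := by simpa [e] using hy
  have hpair : ContMDiffAt 𝓘(ℝ, E) (𝓘(ℝ, E).prod 𝓘(ℝ, E)) ∞
      (fun u => ((extChartAt 𝓘(ℝ, E) a).symm u, v)) (extChartAt 𝓘(ℝ, E) a z) :=
    (contMDiffAt_extChartAt_symm hz).prodMk contMDiffAt_const
  have he : ContMDiffAt (𝓘(ℝ, E).prod 𝓘(ℝ, E)) (𝓘(ℝ, E).prod 𝓘(ℝ, E)) ∞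
      e.toOpenPartialHomeomorph.symm
        ((extChartAt 𝓘(ℝ, E) a).symm (extChartAt 𝓘(ℝ, E) a z), v) := by
    refine e.contMDiffOn_symm.contMDiffAt (e.open_target.mem_nhds (e.mem_target.2 ?_))
    rw [extChartAt_symm_extChartAt hz]
    exact hbase hz
  refine (he.comp (extChartAt 𝓘(ℝ, E) a z) hpair).congr_of_eventuallyEq ?_
  refine (eventually_nhds_extChartAt_iff hz).2 ?_
  filter_upwards [(chartAt E a).open_source.eventually_mem hz] with y hy
  rw [Function.comp, extChartAt_symm_extChartAt hy, ← e.mk_symm (hbase hy), ofCoord,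
    e.symmL_apply (hbase hy)]

variable [RiemannianBundle (fun x : M => TangentSpace 𝓘(ℝ, E) x)]

lemma coordMetric_apply (a : M) (u v w : E) :
    coordMetric a u v w = inner ℝ (ofCoord a ((extChartAt 𝓘(ℝ, E) a).symm u) v)
      (ofCoord a ((extChartAt 𝓘(ℝ, E) a).symm u) w) := rfl

lemma coordMetric_toCoord (hz : z ∈ (chartAt E a).source) (v w : TangentSpace 𝓘(ℝ, E) z) :
    coordMetric a (extChartAt 𝓘(ℝ, E) a z) (toCoord a z v) (toCoord a z w) = inner ℝ v w := by
  rw [coordMetric_apply, extChartAt_symm_extChartAt hz, ofCoord_toCoord hz, ofCoord_toCoord hz]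

variable [FiniteDimensional ℝ E]

lemma sum_coordMetric_smul_stdOrthonormalBasis (hz : z ∈ (chartAt E a).source) (w : E) :
    let e := stdOrthonormalBasis ℝ (TangentSpace 𝓘(ℝ, E) z)
    ∑ i, coordMetric a (extChartAt 𝓘(ℝ, E) a z) w (toCoord a z (e i)) • toCoord a z (e i) = w := by
  intro e
  conv_rhs => rw [← toCoord_ofCoord hz w, ← e.sum_repr' (ofCoord a z w), map_sum]
  refine Finset.sum_congr rfl fun i _ => ?_
  rw [map_smul, ← coordMetric_toCoord hz, toCoord_ofCoord hz, coordMetric_apply, real_inner_comm,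
    ← coordMetric_apply]

lemma isInvertible_coordMetric (hz : z ∈ (chartAt E a).source) :
    (coordMetric a (extChartAt 𝓘(ℝ, E) a z)).IsInvertible := by
  have hinj : Function.Injective (coordMetric a (extChartAt 𝓘(ℝ, E) a z)).toLinearMap := by
    refine (injective_iff_map_eq_zero _).2 fun v hv => ?_
    have hvv : coordMetric a (extChartAt 𝓘(ℝ, E) a z) v v = 0 := DFunLike.congr_fun hv v
    rw [coordMetric_apply, inner_self_eq_zero, extChartAt_symm_extChartAt hz] at hvv
    rw [← toCoord_ofCoord hz v, hvv, map_zero]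
  have hdim : Module.finrank ℝ E = Module.finrank ℝ (E →L[ℝ] ℝ) :=
    Subspace.dual_finrank_eq.symm.trans LinearMap.toContinuousLinearMap.finrank_eq
  exact ⟨(LinearEquiv.ofInjectiveOfFinrankEq _ hinj hdim).toContinuousLinearEquiv, by ext; rfl⟩

lemma metricTrace_toCoord {W κ : Type*} [AddCommGroup W] [Module ℝ W] [Fintype κ]
    (hz : z ∈ (chartAt E a).source) (b : Module.Basis κ ℝ E) (β : E →ₗ[ℝ] E →ₗ[ℝ] W) :
    metricTrace z (fun v w => β (toCoord a z v) (toCoord a z w)) =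
      ∑ j, ∑ k, inverseCoeff (coordMetric a (extChartAt 𝓘(ℝ, E) a z)) b j k • β (b j) (b k) :=
  sum_apply_self_eq_sum_inverseCoeff_smul (isInvertible_coordMetric hz) b
    (sum_coordMetric_smul_stdOrthonormalBasis hz) β

variable [IsContMDiffRiemannianBundle 𝓘(ℝ, E) ∞ E (fun x : M => TangentSpace 𝓘(ℝ, E) x)]

lemma contDiffOn_coordMetric (a : M) :
    ContDiffOn ℝ ∞ (coordMetric a) (extChartAt 𝓘(ℝ, E) a).target := by
  rw [← (extChartAt 𝓘(ℝ, E) a).image_source_eq_target, extChartAt_source]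
  refine contDiffOn_clm_apply.2 fun v => contDiffOn_clm_apply.2 fun w => ?_
  rintro _ ⟨z, hz, rfl⟩
  exact (contMDiffAt_iff_contDiffAt.1 (ContMDiffAt.inner_bundle (IB := 𝓘(ℝ, E)) (F := E)
    (E := fun x : M => TangentSpace 𝓘(ℝ, E) x) (contMDiffAt_ofCoord hz v)
    (contMDiffAt_ofCoord hz w))).contDiffWithinAt

lemma isMetricAt_coordMetric (hz : z ∈ (chartAt E a).source) :
    IsMetricAt (coordMetric a) (extChartAt 𝓘(ℝ, E) a z) where
  contDiffAt := (contDiffOn_coordMetric a).contDiffAt <|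
    (isOpen_extChartAt_target a).mem_nhds ((extChartAt 𝓘(ℝ, E) a).map_source (by simpa using hz))
  symm := Eventually.of_forall fun u v w => by
    rw [coordMetric_apply, coordMetric_apply, real_inner_comm]
  isInvertible := isInvertible_coordMetric hz

end Charts

section MapsInCharts

variable {E : Type*} [NormedAddCommGroup E] [NormedSpace ℝ E]
  {M : Type*} [TopologicalSpace M] [ChartedSpace E M]
  {F : Type*} [NormedAddCommGroup F] [NormedSpace ℝ F]
  {N : Type*} [TopologicalSpace N] [ChartedSpace F N]
  {G : Type*} [NormedAddCommGroup G] [NormedSpace ℝ G]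
  {P : Type*} [TopologicalSpace P] [ChartedSpace G P]
  {φ : M → N} {a z : M} {b : N}

variable (E F) in
/-- The map `φ` in the charts around `a` and `b`. The charts are free, unlike in `coordMap φ x`,
which is `mapInCharts E F φ x (φ x)`. -/
noncomputable def mapInCharts (φ : M → N) (a : M) (b : N) : E → F :=
  extChartAt 𝓘(ℝ, F) b ∘ φ ∘ (extChartAt 𝓘(ℝ, E) a).symm

lemma mapInCharts_extChartAt (hz : z ∈ (chartAt E a).source) :
    mapInCharts E F φ a b (extChartAt 𝓘(ℝ, E) a z) = extChartAt 𝓘(ℝ, F) b (φ z) := by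
  rw [mapInCharts, Function.comp, Function.comp, extChartAt_symm_extChartAt hz]

lemma mapInCharts_comp {ψ : N → P} (hφ : ContinuousAt φ z) (hz : z ∈ (chartAt E a).source)
    (hb : φ z ∈ (chartAt F b).source) (c : P) :
    mapInCharts F G ψ b c ∘ mapInCharts E F φ a b
      =ᶠ[𝓝 (extChartAt 𝓘(ℝ, E) a z)] mapInCharts E G (ψ ∘ φ) a c := by
  refine eventually_of_forall_extChartAt hφ hz hb fun y hy hby => ?_
  rw [Function.comp_apply, mapInCharts_extChartAt hy, mapInCharts_extChartAt hby,
    mapInCharts_extChartAt hy, Function.comp_apply]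

lemma isMetricAt_coordMetric_mapInCharts [IsManifold 𝓘(ℝ, F) ∞ N] [FiniteDimensional ℝ F]
    [RiemannianBundle (fun y : N => TangentSpace 𝓘(ℝ, F) y)]
    [IsContMDiffRiemannianBundle 𝓘(ℝ, F) ∞ F (fun y : N => TangentSpace 𝓘(ℝ, F) y)]
    (hz : z ∈ (chartAt E a).source) (hb : φ z ∈ (chartAt F b).source) :
    IsMetricAt (coordMetric b) (mapInCharts E F φ a b (extChartAt 𝓘(ℝ, E) a z)) := by
  rw [mapInCharts_extChartAt hz]
  exact isMetricAt_coordMetric hb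

variable [IsManifold 𝓘(ℝ, E) ∞ M] [IsManifold 𝓘(ℝ, F) ∞ N]

lemma contDiffAt_mapInCharts (hφ : ContMDiffAt 𝓘(ℝ, E) 𝓘(ℝ, F) ∞ φ z)
    (hz : z ∈ (chartAt E a).source) (hb : φ z ∈ (chartAt F b).source) :
    ContDiffAt ℝ ∞ (mapInCharts E F φ a b) (extChartAt 𝓘(ℝ, E) a z) := by
  have hz' := extChartAt_symm_extChartAt hz
  have hφ' := ContMDiffAt.comp (extChartAt 𝓘(ℝ, E) a z) (hz'.symm ▸ hφ)
    (contMDiffAt_extChartAt_symm hz)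
  have hb' : (φ ∘ (extChartAt 𝓘(ℝ, E) a).symm) (extChartAt 𝓘(ℝ, E) a z) ∈
      (chartAt F b).source := by
    rwa [Function.comp_apply, hz']
  exact contMDiffAt_iff_contDiffAt.1 ((contMDiffAt_extChartAt' hb').comp _ hφ')

lemma fderiv_mapInCharts (hφ : MDifferentiableAt 𝓘(ℝ, E) 𝓘(ℝ, F) φ z)
    (hz : z ∈ (chartAt E a).source) (hb : φ z ∈ (chartAt F b).source) (v : E) :
    fderiv ℝ (mapInCharts E F φ a b) (extChartAt 𝓘(ℝ, E) a z) v =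
      toCoord b (φ z) (mfderiv 𝓘(ℝ, E) 𝓘(ℝ, F) φ z (ofCoord a z v)) := by
  have hz' := extChartAt_symm_extChartAt hz
  have hsymm : MDifferentiableAt 𝓘(ℝ, E) 𝓘(ℝ, E) (extChartAt 𝓘(ℝ, E) a).symm
      (extChartAt 𝓘(ℝ, E) a z) := (contMDiffAt_extChartAt_symm hz).mdifferentiableAt (by simp)
  have hφ' : MDifferentiableAt 𝓘(ℝ, E) 𝓘(ℝ, F) φ
      ((extChartAt 𝓘(ℝ, E) a).symm (extChartAt 𝓘(ℝ, E) a z)) := by rwa [hz']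
  have hext : MDifferentiableAt 𝓘(ℝ, F) 𝓘(ℝ, F) (extChartAt 𝓘(ℝ, F) b)
      (φ ((extChartAt 𝓘(ℝ, E) a).symm (extChartAt 𝓘(ℝ, E) a z))) :=
    mdifferentiableAt_extChartAt (hz'.symm ▸ hb)
  rw [toCoord, TangentBundle.continuousLinearMapAt_trivializationAt hb, ofCoord,
    TangentBundle.symmL_trivializationAt hz, ModelWithCorners.range_eq_univ, mfderivWithin_univ,
    ← mfderiv_eq_fderiv, mapInCharts, mfderiv_comp (extChartAt 𝓘(ℝ, E) a z) hext (hφ'.comp _ hsymm),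
    mfderiv_comp (extChartAt 𝓘(ℝ, E) a z) hφ' hsymm, Function.comp_apply, hz']
  rfl

lemma fderiv_mapInCharts_toCoord (hφ : MDifferentiableAt 𝓘(ℝ, E) 𝓘(ℝ, F) φ z)
    (hz : z ∈ (chartAt E a).source) (hb : φ z ∈ (chartAt F b).source)
    (v : TangentSpace 𝓘(ℝ, E) z) :
    fderiv ℝ (mapInCharts E F φ a b) (extChartAt 𝓘(ℝ, E) a z) (toCoord a z v) =
      toCoord b (φ z) (mfderiv 𝓘(ℝ, E) 𝓘(ℝ, F) φ z v) := by
  rw [fderiv_mapInCharts hφ hz hb, ofCoord_toCoord hz]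

lemma fderiv_mapInCharts_id {b' : M} (ha : z ∈ (chartAt E a).source)
    (hb' : z ∈ (chartAt E b').source) (v : E) :
    fderiv ℝ (mapInCharts E E (id : M → M) a b') (extChartAt 𝓘(ℝ, E) a z) v =
      toCoord b' z (ofCoord a z v) := by
  rw [fderiv_mapInCharts (φ := id) mdifferentiableAt_id ha hb', mfderiv_id]
  rfl

end MapsInCharts

/-! ### The second fundamental form -/

section IsometricImmersions

variable {E : Type*} [NormedAddCommGroup E] [NormedSpace ℝ E]
  {M : Type*} [TopologicalSpace M] [ChartedSpace E M]
  [RiemannianBundle (fun x : M => TangentSpace 𝓘(ℝ, E) x)]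
  {F : Type*} [NormedAddCommGroup F] [NormedSpace ℝ F]
  {N : Type*} [TopologicalSpace N] [ChartedSpace F N]
  [RiemannianBundle (fun y : N => TangentSpace 𝓘(ℝ, F) y)]
  {φ : M → N} {a z : M} {b : N}

lemma isIsometricImmersion_id : IsIsometricImmersion E E (id : M → M) where
  contMDiff := contMDiff_id
  inner_mfderiv x v w := by rw [mfderiv_id]; rfl

lemma IsIsometricImmersion.mdifferentiableAt (hφ : IsIsometricImmersion E F φ) (z : M) :
    MDifferentiableAt 𝓘(ℝ, E) 𝓘(ℝ, F) φ z :=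
  hφ.contMDiff.contMDiffAt.mdifferentiableAt (by simp)

variable [IsManifold 𝓘(ℝ, E) ∞ M] [IsManifold 𝓘(ℝ, F) ∞ N]

lemma IsIsometricImmersion.coordMetric_eq (hφ : IsIsometricImmersion E F φ)
    (hz : z ∈ (chartAt E a).source) (hb : φ z ∈ (chartAt F b).source) (v w : E) :
    coordMetric a (extChartAt 𝓘(ℝ, E) a z) v w =
      coordMetric b (mapInCharts E F φ a b (extChartAt 𝓘(ℝ, E) a z))
        (fderiv ℝ (mapInCharts E F φ a b) (extChartAt 𝓘(ℝ, E) a z) v)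
        (fderiv ℝ (mapInCharts E F φ a b) (extChartAt 𝓘(ℝ, E) a z) w) := by
  have hd := hφ.mdifferentiableAt z
  rw [fderiv_mapInCharts hd hz hb, fderiv_mapInCharts hd hz hb, mapInCharts_extChartAt hz,
    coordMetric_toCoord hb, hφ.inner_mfderiv, coordMetric_apply, extChartAt_symm_extChartAt hz]

lemma IsIsometricImmersion.eventually_coordMetric_eq (hφ : IsIsometricImmersion E F φ)
    (hz : z ∈ (chartAt E a).source) (hb : φ z ∈ (chartAt F b).source) :
    ∀ᶠ u in 𝓝 (extChartAt 𝓘(ℝ, E) a z), ∀ v w, coordMetric a u v w =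
      coordMetric b (mapInCharts E F φ a b u) (fderiv ℝ (mapInCharts E F φ a b) u v)
        (fderiv ℝ (mapInCharts E F φ a b) u w) :=
  eventually_of_forall_extChartAt hφ.contMDiff.continuous.continuousAt hz hb fun _ =>
    hφ.coordMetric_eq

end IsometricImmersions

section SourceCharts

variable {E : Type*} [NormedAddCommGroup E] [NormedSpace ℝ E]
  {M : Type*} [TopologicalSpace M] [ChartedSpace E M] [IsManifold 𝓘(ℝ, E) ∞ M]
  [RiemannianBundle (fun x : M => TangentSpace 𝓘(ℝ, E) x)] [FiniteDimensional ℝ E]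
  [IsContMDiffRiemannianBundle 𝓘(ℝ, E) ∞ E (fun x : M => TangentSpace 𝓘(ℝ, E) x)]
  {F : Type*} [NormedAddCommGroup F] [NormedSpace ℝ F]
  {N : Type*} [TopologicalSpace N] [ChartedSpace F N] [IsManifold 𝓘(ℝ, F) ∞ N]
  {φ : M → N} {a z : M} {b : N}

lemma coordSecondForm_mapInCharts_id {b : M} (ha : z ∈ (chartAt E a).source)
    (hb : z ∈ (chartAt E b).source) (v w : E) :
    coordSecondForm (coordMetric a) (coordMetric b) (mapInCharts E E (id : M → M) a b)
      (extChartAt 𝓘(ℝ, E) a z) v w = 0 := by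
  refine coordSecondForm_eq_zero (isMetricAt_coordMetric ha)
    (isMetricAt_coordMetric_mapInCharts ha hb)
    ((contDiffAt_mapInCharts contMDiffAt_id ha hb).of_le ENat.LEInfty.out)
    (isIsometricImmersion_id.eventually_coordMetric_eq ha hb) (fun c => ?_) v w
  refine ⟨toCoord a z (ofCoord b z c), ?_⟩
  rw [fderiv_mapInCharts_id ha hb, ofCoord_toCoord ha, toCoord_ofCoord hb]

lemma coordSecondForm_mapInCharts_source {h : F → F →L[ℝ] F →L[ℝ] ℝ} {a' : M}
    (hφ : ContMDiffAt 𝓘(ℝ, E) 𝓘(ℝ, F) ∞ φ z) (ha : z ∈ (chartAt E a).source)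
    (ha' : z ∈ (chartAt E a').source) (hb : φ z ∈ (chartAt F b).source)
    (v w : TangentSpace 𝓘(ℝ, E) z) :
    coordSecondForm (coordMetric a) h (mapInCharts E F φ a b)
        (extChartAt 𝓘(ℝ, E) a z) (toCoord a z v) (toCoord a z w) =
      coordSecondForm (coordMetric a') h (mapInCharts E F φ a' b)
        (extChartAt 𝓘(ℝ, E) a' z) (toCoord a' z v) (toCoord a' z w) := by
  have hcomp := mapInCharts_comp (E := E) (F := E) (G := F) (φ := id) (ψ := φ)
    continuousAt_id ha ha' b
  have hid : mapInCharts E E (id : M → M) a a' (extChartAt 𝓘(ℝ, E) a z) =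
      extChartAt 𝓘(ℝ, E) a' z := mapInCharts_extChartAt ha
  have hφ' : ContDiffAt ℝ 2 (mapInCharts E F φ a' b)
      (mapInCharts E E (id : M → M) a a' (extChartAt 𝓘(ℝ, E) a z)) := by
    rw [hid]
    exact (contDiffAt_mapInCharts hφ ha' hb).of_le ENat.LEInfty.out
  rw [← Function.comp_id φ, ← coordSecondForm_congr hcomp,
    coordSecondForm_comp (h := coordMetric a') hφ'
      ((contDiffAt_mapInCharts contMDiffAt_id ha ha').of_le ENat.LEInfty.out),
    coordSecondForm_mapInCharts_id ha ha', map_zero, add_zero, hid, fderiv_mapInCharts_id ha ha',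
    fderiv_mapInCharts_id ha ha', ofCoord_toCoord ha, ofCoord_toCoord ha, Function.comp_id]

end SourceCharts

section TargetCharts

variable {E : Type*} [NormedAddCommGroup E] [NormedSpace ℝ E]
  {M : Type*} [TopologicalSpace M] [ChartedSpace E M] [IsManifold 𝓘(ℝ, E) ∞ M]
  {F : Type*} [NormedAddCommGroup F] [NormedSpace ℝ F]
  {N : Type*} [TopologicalSpace N] [ChartedSpace F N] [IsManifold 𝓘(ℝ, F) ∞ N]
  [RiemannianBundle (fun y : N => TangentSpace 𝓘(ℝ, F) y)] [FiniteDimensional ℝ F]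
  [IsContMDiffRiemannianBundle 𝓘(ℝ, F) ∞ F (fun y : N => TangentSpace 𝓘(ℝ, F) y)]
  {φ : M → N} {a z : M} {b : N}

lemma coordSecondForm_mapInCharts_target {g : E → E →L[ℝ] E →L[ℝ] ℝ} {b' : N}
    (hφ : ContMDiffAt 𝓘(ℝ, E) 𝓘(ℝ, F) ∞ φ z) (ha : z ∈ (chartAt E a).source)
    (hb : φ z ∈ (chartAt F b).source) (hb' : φ z ∈ (chartAt F b').source) (v w : E) :
    coordSecondForm g (coordMetric b') (mapInCharts E F φ a b') (extChartAt 𝓘(ℝ, E) a z) v w =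
      toCoord b' (φ z) (ofCoord b (φ z) (coordSecondForm g (coordMetric b)
        (mapInCharts E F φ a b) (extChartAt 𝓘(ℝ, E) a z) v w)) := by
  have hcomp := mapInCharts_comp (E := E) (F := F) (G := F) (ψ := id) hφ.continuousAt ha hb b'
  have hφz : mapInCharts E F φ a b (extChartAt 𝓘(ℝ, E) a z) = extChartAt 𝓘(ℝ, F) b (φ z) :=
    mapInCharts_extChartAt ha
  have hid : ContDiffAt ℝ 2 (mapInCharts F F (id : N → N) b b')
      (mapInCharts E F φ a b (extChartAt 𝓘(ℝ, E) a z)) := by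
    rw [hφz]
    exact (contDiffAt_mapInCharts contMDiffAt_id hb hb').of_le ENat.LEInfty.out
  rw [← Function.id_comp φ, ← coordSecondForm_congr hcomp,
    coordSecondForm_comp (h := coordMetric b) hid
      ((contDiffAt_mapInCharts hφ ha hb).of_le ENat.LEInfty.out),
    hφz, coordSecondForm_mapInCharts_id hb hb', zero_add, fderiv_mapInCharts_id hb hb',
    Function.id_comp]

end TargetCharts

section SecondFundamentalForm

variable {E : Type*} [NormedAddCommGroup E] [NormedSpace ℝ E]
  {M : Type*} [TopologicalSpace M] [ChartedSpace E M] [IsManifold 𝓘(ℝ, E) ∞ M]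
  [RiemannianBundle (fun x : M => TangentSpace 𝓘(ℝ, E) x)]
  {F : Type*} [NormedAddCommGroup F] [NormedSpace ℝ F]
  {N : Type*} [TopologicalSpace N] [ChartedSpace F N] [IsManifold 𝓘(ℝ, F) ∞ N]
  [RiemannianBundle (fun y : N => TangentSpace 𝓘(ℝ, F) y)]
  {φ : M → N} {a z : M} {b : N} [FiniteDimensional ℝ E]

lemma finrank_smul_meanCurvature (φ : M → N) (x : M) :
    (Module.finrank ℝ E : ℝ) • meanCurvature E F φ x =
      metricTrace x (secondFundamentalForm E F φ x) := by
  rw [meanCurvature]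
  rcases eq_or_ne (Module.finrank ℝ E) 0 with hm | hm
  · have : IsEmpty (Fin (Module.finrank ℝ (TangentSpace 𝓘(ℝ, E) x))) := hm ▸ Fin.isEmpty
    rw [metricTrace, Finset.univ_eq_empty, Finset.sum_empty, smul_zero, smul_zero]
  · exact smul_inv_smul₀ (by exact_mod_cast hm) _

variable [IsContMDiffRiemannianBundle 𝓘(ℝ, E) ∞ E (fun x : M => TangentSpace 𝓘(ℝ, E) x)]
  [FiniteDimensional ℝ F]
  [IsContMDiffRiemannianBundle 𝓘(ℝ, F) ∞ F (fun y : N => TangentSpace 𝓘(ℝ, F) y)]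

lemma toCoord_secondFundamentalForm (hφ : ContMDiffAt 𝓘(ℝ, E) 𝓘(ℝ, F) ∞ φ z)
    (hz : z ∈ (chartAt E a).source) (hb : φ z ∈ (chartAt F b).source)
    (v w : TangentSpace 𝓘(ℝ, E) z) :
    toCoord b (φ z) (secondFundamentalForm E F φ z v w) =
      coordSecondForm (coordMetric a) (coordMetric b) (mapInCharts E F φ a b)
        (extChartAt 𝓘(ℝ, E) a z) (toCoord a z v) (toCoord a z w) := by
  have hzz := mem_chart_source E z
  rw [coordSecondForm_mapInCharts_source hφ hz hzz hb,
    coordSecondForm_mapInCharts_target hφ hzz (mem_chart_source F (φ z)) hb]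
  rfl

lemma IsIsometricImmersion.inner_secondFundamentalForm_mfderiv
    (hφ : IsIsometricImmersion E F φ) (v w c : TangentSpace 𝓘(ℝ, E) z) :
    ⟪secondFundamentalForm E F φ z v w, mfderiv 𝓘(ℝ, E) 𝓘(ℝ, F) φ z c⟫ = 0 := by
  have hz := mem_chart_source E z
  have hφz := mem_chart_source F (φ z)
  rw [← coordMetric_toCoord hφz, toCoord_secondFundamentalForm hφ.contMDiff.contMDiffAt hz hφz,
    ← fderiv_mapInCharts_toCoord (hφ.mdifferentiableAt z) hz hφz,
    ← mapInCharts_extChartAt (φ := φ) (b := φ z) hz]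
  exact metric_coordSecondForm_fderiv (isMetricAt_coordMetric hz)
    (isMetricAt_coordMetric_mapInCharts hz hφz)
    ((contDiffAt_mapInCharts hφ.contMDiff.contMDiffAt hz hφz).of_le ENat.LEInfty.out)
    (hφ.eventually_coordMetric_eq hz hφz) _ _ _

lemma IsIsometricImmersion.inner_meanCurvature_mfderiv (hφ : IsIsometricImmersion E F φ)
    (c : TangentSpace 𝓘(ℝ, E) z) :
    ⟪meanCurvature E F φ z, mfderiv 𝓘(ℝ, E) 𝓘(ℝ, F) φ z c⟫ = 0 := by
  rw [meanCurvature, metricTrace, real_inner_smul_left, sum_inner]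
  simp [hφ.inner_secondFundamentalForm_mfderiv]

lemma coordField_meanCurvature_extChartAt {κ : Type*} [Fintype κ]
    (hφ : ContMDiffAt 𝓘(ℝ, E) 𝓘(ℝ, F) ∞ φ z) (hz : z ∈ (chartAt E a).source)
    (hφz : φ z ∈ (chartAt F (φ a)).source) (b : Module.Basis κ ℝ E) :
    coordField φ (meanCurvature E F φ) a (extChartAt 𝓘(ℝ, E) a z) =
      (Module.finrank ℝ E : ℝ)⁻¹ • ∑ j, ∑ k,
        inverseCoeff (coordMetric a (extChartAt 𝓘(ℝ, E) a z)) b j k •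
          coordSecondForm (coordMetric a) (coordMetric (φ a)) (coordMap φ a)
            (extChartAt 𝓘(ℝ, E) a z) (b j) (b k) := by
  have hf : ContDiffAt ℝ 2 (coordMap φ a) (extChartAt 𝓘(ℝ, E) a z) :=
    (contDiffAt_mapInCharts hφ hz hφz).of_le ENat.LEInfty.out
  rw [coordField, extChartAt_symm_extChartAt hz, meanCurvature, map_smul]
  simp only [← secondFormBilin_apply hf]
  rw [← metricTrace_toCoord hz, metricTrace, metricTrace, map_sum]
  congr! 2 with i
  rw [toCoord_secondFundamentalForm hφ hz hφz, secondFormBilin_apply hf]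
  rfl

lemma contDiffAt_coordField_meanCurvature (hφ : ContMDiff 𝓘(ℝ, E) 𝓘(ℝ, F) ∞ φ) (x : M) :
    ContDiffAt ℝ ∞ (coordField φ (meanCurvature E F φ) x) (extChartAt 𝓘(ℝ, E) x x) := by
  have hx := mem_chart_source E x
  have hφx := mem_chart_source F (φ x)
  let b := Module.finBasis ℝ E
  have hg : IsMetricAt (coordMetric x) (extChartAt 𝓘(ℝ, E) x x) := isMetricAt_coordMetric hx
  have hh : IsMetricAt (coordMetric (E := F) (φ x)) (coordMap φ x (extChartAt 𝓘(ℝ, E) x x)) :=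
    isMetricAt_coordMetric_mapInCharts hx hφx
  have hformula : coordField φ (meanCurvature E F φ) x =ᶠ[𝓝 (extChartAt 𝓘(ℝ, E) x x)] fun u =>
      (Module.finrank ℝ E : ℝ)⁻¹ • ∑ j, ∑ k, inverseCoeff (coordMetric x u) b j k •
        coordSecondForm (coordMetric x) (coordMetric (φ x)) (coordMap φ x) u (b j) (b k) :=
    eventually_of_forall_extChartAt hφ.continuous.continuousAt hx hφx fun y hy hφy =>
      coordField_meanCurvature_extChartAt hφ.contMDiffAt hy hφy b
  refine ContDiffAt.congr_of_eventuallyEq ?_ hformula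
  exact contDiffAt_const.fun_smul <| ContDiffAt.sum fun j _ => ContDiffAt.sum fun k _ =>
    (hg.contDiffAt_inverseCoeff b j k).fun_smul <| contDiffAt_coordSecondForm (n := ⊤) hg hh
      (contDiffAt_mapInCharts hφ.contMDiffAt hx hφx) _ _

end SecondFundamentalForm

/-! ### The Bochner formula and the mean curvature of biminimal submanifolds -/

section Curvature

variable {E : Type*} [NormedAddCommGroup E] [NormedSpace ℝ E]
  {M : Type*} [TopologicalSpace M] [ChartedSpace E M] [IsManifold 𝓘(ℝ, E) ∞ M]
  [RiemannianBundle (fun x : M => TangentSpace 𝓘(ℝ, E) x)] {x : M}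

lemma curvature_zero_right (X Y : TangentSpace 𝓘(ℝ, E) x) : curvature x X Y 0 = 0 := by
  rw [curvature, (toCoord x x).map_zero, coordCurvature_zero_right, map_zero]

lemma NonposSectionalCurvature.inner_curvature_nonpos (hM : NonposSectionalCurvature E M)
    {X Y : TangentSpace 𝓘(ℝ, E) x} (hXY : ⟪X, Y⟫ = 0) : ⟪curvature x X Y Y, X⟫ ≤ 0 := by
  rcases eq_or_ne X 0 with hX | hX
  · rw [hX, inner_zero_right]
  rcases eq_or_ne Y 0 with rfl | hY
  · rw [curvature_zero_right, inner_zero_left]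
  have hli : LinearIndependent ℝ ![X, Y] := by
    refine linearIndependent_of_ne_zero_of_inner_eq_zero
      (fun i => by fin_cases i <;> simpa) fun i j hij => ?_
    fin_cases i <;> fin_cases j <;> simp_all [real_inner_comm]
  have hpos : 0 < ‖X‖ ^ 2 * ‖Y‖ ^ 2 - ⟪X, Y⟫ ^ 2 := by
    have := norm_pos_iff.2 hX
    have := norm_pos_iff.2 hY
    rw [hXY, zero_pow two_ne_zero, sub_zero]
    positivity
  simpa only [sectionalCurvature, div_le_iff₀ hpos, zero_mul] using hM x X Y hli

end Curvature

section Bochner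

variable {E : Type*} [NormedAddCommGroup E] [NormedSpace ℝ E]
  {M : Type*} [TopologicalSpace M] [ChartedSpace E M]
  {F : Type*} [NormedAddCommGroup F] [NormedSpace ℝ F]
  {N : Type*} [TopologicalSpace N] [ChartedSpace F N]
  {φ : M → N} {V : ∀ y : M, TangentSpace 𝓘(ℝ, F) (φ y)} {x : M}

lemma coordMap_extChartAt (φ : M → N) (x : M) :
    coordMap φ x (extChartAt 𝓘(ℝ, E) x x) = extChartAt 𝓘(ℝ, F) (φ x) (φ x) :=
  mapInCharts_extChartAt (mem_chart_source E x)

variable [IsManifold 𝓘(ℝ, F) ∞ N]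

lemma coordField_extChartAt {y : M} (hy : y ∈ (chartAt E x).source) :
    coordField φ V x (extChartAt 𝓘(ℝ, E) x y) = toCoord (φ x) (φ y) (V y) := by
  rw [coordField, extChartAt_symm_extChartAt hy]

variable [RiemannianBundle (fun y : N => TangentSpace 𝓘(ℝ, F) y)]

lemma coordMetric_coordField {y : M} (hy : y ∈ (chartAt E x).source)
    (hφy : φ y ∈ (chartAt F (φ x)).source) (w : TangentSpace 𝓘(ℝ, F) (φ y)) :
    coordMetric (φ x) (coordMap φ x (extChartAt 𝓘(ℝ, E) x y))
      (coordField φ V x (extChartAt 𝓘(ℝ, E) x y)) (toCoord (φ x) (φ y) w) = ⟪V y, w⟫ := by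
  rw [coordField_extChartAt hy, ← coordMetric_toCoord hφy]
  exact congrArg (coordMetric (φ x) · _ _) (mapInCharts_extChartAt hy)

variable [IsManifold 𝓘(ℝ, E) ∞ M]

variable (E) in
/-- The covariant derivative `∇^φ_v V` at `x` of a vector field `V` along `φ`. -/
noncomputable def pullbackDeriv (φ : M → N) (V : ∀ y : M, TangentSpace 𝓘(ℝ, F) (φ y)) (x : M)
    (v : TangentSpace 𝓘(ℝ, E) x) : TangentSpace 𝓘(ℝ, F) (φ x) :=
  ofCoord (φ x) (φ x) (covAlong (coordMetric (φ x)) (coordMap φ x) (coordField φ V x)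
    (extChartAt 𝓘(ℝ, E) x x) (toCoord x x v))

variable [RiemannianBundle (fun x : M => TangentSpace 𝓘(ℝ, E) x)]
  [FiniteDimensional ℝ F]
  [IsContMDiffRiemannianBundle 𝓘(ℝ, F) ∞ F (fun y : N => TangentSpace 𝓘(ℝ, F) y)]

lemma laplacian_norm_sq [FiniteDimensional ℝ E] (hφ : ContMDiff 𝓘(ℝ, E) 𝓘(ℝ, F) ∞ φ)
    (hV : ContDiffAt ℝ 2 (coordField φ V x) (extChartAt 𝓘(ℝ, E) x x)) :
    laplacian E (fun y => ‖V y‖ ^ 2) x =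
      2 * ⟪roughLaplacian E φ V x, V x⟫ + 2 * metricTrace x fun v w : TangentSpace 𝓘(ℝ, E) x =>
        ⟪pullbackDeriv E φ V x v, pullbackDeriv E φ V x w⟫ := by
  have hx := mem_chart_source E x
  have hφx := mem_chart_source F (φ x)
  have hf : ContDiffAt ℝ 2 (coordMap φ x) (extChartAt 𝓘(ℝ, E) x x) :=
    (contDiffAt_mapInCharts hφ.contMDiffAt hx hφx).of_le ENat.LEInfty.out
  have hh : ∀ᶠ u in 𝓝 (extChartAt 𝓘(ℝ, E) x x),
      IsMetricAt (coordMetric (E := F) (φ x)) (coordMap φ x u) :=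
    eventually_of_forall_extChartAt hφ.continuous.continuousAt hx hφx fun y hy hφy =>
      isMetricAt_coordMetric_mapInCharts hy hφy
  have hnorm : (fun y => ‖V y‖ ^ 2) ∘ (extChartAt 𝓘(ℝ, E) x).symm
      =ᶠ[𝓝 (extChartAt 𝓘(ℝ, E) x x)]
      fun u => coordMetric (φ x) (coordMap φ x u) (coordField φ V x u) (coordField φ V x u) :=
    eventually_of_forall_extChartAt hφ.continuous.continuousAt hx hφx fun y hy hφy => by
      rw [Function.comp, extChartAt_symm_extChartAt hy, ← real_inner_self_eq_norm_sq,
        ← coordMetric_coordField hy hφy, ← coordField_extChartAt hy]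
  simp only [laplacian, roughLaplacian, metricTrace, sum_inner]
  rw [Finset.mul_sum, Finset.mul_sum, ← Finset.sum_add_distrib]
  refine Finset.sum_congr rfl fun i _ => ?_
  rw [coordHess_congr hnorm, coordHess_metric_self hh hf hV, coordMap_extChartAt,
    coordField_extChartAt hx, ← coordMetric_toCoord hφx, ← coordMetric_toCoord hφx,
    toCoord_ofCoord hφx, pullbackDeriv, toCoord_ofCoord hφx]

lemma inner_pullbackDeriv_mfderiv (hφ : ContMDiff 𝓘(ℝ, E) 𝓘(ℝ, F) ∞ φ)
    (hV : DifferentiableAt ℝ (coordField φ V x) (extChartAt 𝓘(ℝ, E) x x))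
    (hnormal : ∀ y c, ⟪V y, mfderiv 𝓘(ℝ, E) 𝓘(ℝ, F) φ y c⟫ = 0) (v w : TangentSpace 𝓘(ℝ, E) x) :
    ⟪pullbackDeriv E φ V x v, mfderiv 𝓘(ℝ, E) 𝓘(ℝ, F) φ x w⟫ =
      - ⟪V x, secondFundamentalForm E F φ x v w⟫ := by
  have hx := mem_chart_source E x
  have hφx := mem_chart_source F (φ x)
  have hd (y : M) : MDifferentiableAt 𝓘(ℝ, E) 𝓘(ℝ, F) φ y :=
    hφ.contMDiffAt.mdifferentiableAt (by simp)
  have hf : ContDiffAt ℝ 2 (coordMap φ x) (extChartAt 𝓘(ℝ, E) x x) :=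
    (contDiffAt_mapInCharts hφ.contMDiffAt hx hφx).of_le ENat.LEInfty.out
  have hh : IsMetricAt (coordMetric (E := F) (φ x)) (coordMap φ x (extChartAt 𝓘(ℝ, E) x x)) :=
    isMetricAt_coordMetric_mapInCharts hx hφx
  have hnormal' : ∀ᶠ u in 𝓝 (extChartAt 𝓘(ℝ, E) x x), ∀ c,
      coordMetric (φ x) (coordMap φ x u) (coordField φ V x u) (fderiv ℝ (coordMap φ x) u c) = 0 :=
    eventually_of_forall_extChartAt hφ.continuous.continuousAt hx hφx fun y hy hφy c => by
      rw [show coordMap φ x = mapInCharts E F φ x (φ x) from rfl, fderiv_mapInCharts (hd y) hy hφy]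
      exact (coordMetric_coordField hy hφy _).trans (hnormal y _)
  have hcoord := metric_covAlong_fderiv (g := coordMetric x) hh hf hV hnormal'
    (toCoord x x v) (toCoord x x w)
  rw [coordMap_extChartAt, coordField_extChartAt hx] at hcoord
  rw [← coordMetric_toCoord hφx, ← coordMetric_toCoord hφx, pullbackDeriv, secondFundamentalForm,
    toCoord_ofCoord hφx, toCoord_ofCoord hφx, ← hcoord,
    ← fderiv_mapInCharts_toCoord (hd x) hx hφx]
  rfl

end Bochner

section Biminimal

variable {E : Type*} [NormedAddCommGroup E] [NormedSpace ℝ E]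
  {M : Type*} [TopologicalSpace M] [ChartedSpace E M]
  {F : Type*} [NormedAddCommGroup F] [NormedSpace ℝ F]
  {N : Type*} [TopologicalSpace N] [ChartedSpace F N]
  [RiemannianBundle (fun y : N => TangentSpace 𝓘(ℝ, F) y)]
  {φ : M → N} {x : M} [FiniteDimensional ℝ E]

lemma inner_normalPart_of_normal (W : TangentSpace 𝓘(ℝ, F) (φ x)) {ν : TangentSpace 𝓘(ℝ, F) (φ x)}
    (hν : ∀ c, ⟪ν, mfderiv 𝓘(ℝ, E) 𝓘(ℝ, F) φ x c⟫ = 0) :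
    ⟪normalPart E φ x W, ν⟫ = ⟪W, ν⟫ := by
  obtain ⟨c, hc⟩ := Submodule.starProjection_apply_mem
    (LinearMap.range (mfderiv 𝓘(ℝ, E) 𝓘(ℝ, F) φ x).toLinearMap) W
  rw [normalPart, inner_sub_left, ← hc, sub_eq_self, real_inner_comm]
  exact hν c

variable [RiemannianBundle (fun x : M => TangentSpace 𝓘(ℝ, E) x)]

lemma sq_metricTrace_le (β : TangentSpace 𝓘(ℝ, E) x → TangentSpace 𝓘(ℝ, E) x → ℝ) :
    metricTrace x β ^ 2 ≤ Module.finrank ℝ E * metricTrace x fun v w => β v w ^ 2 := by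
  have hcard : (Finset.univ : Finset (Fin (Module.finrank ℝ (TangentSpace 𝓘(ℝ, E) x)))).card =
      Module.finrank ℝ E := Finset.card_fin _
  rw [← hcard]
  exact sq_sum_le_card_mul_sum_sq

variable [IsManifold 𝓘(ℝ, E) ∞ M]
  [IsContMDiffRiemannianBundle 𝓘(ℝ, E) ∞ E (fun x : M => TangentSpace 𝓘(ℝ, E) x)]
  [IsManifold 𝓘(ℝ, F) ∞ N] [FiniteDimensional ℝ F]
  [IsContMDiffRiemannianBundle 𝓘(ℝ, F) ∞ F (fun y : N => TangentSpace 𝓘(ℝ, F) y)]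

lemma IsIsometricImmersion.inner_pullbackDeriv_meanCurvature_mfderiv
    (hφ : IsIsometricImmersion E F φ) (v w : TangentSpace 𝓘(ℝ, E) x) :
    ⟪pullbackDeriv E φ (meanCurvature E F φ) x v, mfderiv 𝓘(ℝ, E) 𝓘(ℝ, F) φ x w⟫ =
      - ⟪meanCurvature E F φ x, secondFundamentalForm E F φ x v w⟫ :=
  inner_pullbackDeriv_mfderiv hφ.contMDiff
    ((contDiffAt_coordField_meanCurvature hφ.contMDiff x).differentiableAt (by simp))
    (fun _ c => hφ.inner_meanCurvature_mfderiv c) v w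

lemma IsIsometricImmersion.sq_inner_secondFundamentalForm_le (hφ : IsIsometricImmersion E F φ)
    (v : TangentSpace 𝓘(ℝ, E) x) {w : TangentSpace 𝓘(ℝ, E) x} (hw : ‖w‖ = 1) :
    ⟪meanCurvature E F φ x, secondFundamentalForm E F φ x v w⟫ ^ 2 ≤
      ‖pullbackDeriv E φ (meanCurvature E F φ) x v‖ ^ 2 := by
  have hcs := real_inner_mul_inner_self_le (pullbackDeriv E φ (meanCurvature E F φ) x v)
    (mfderiv 𝓘(ℝ, E) 𝓘(ℝ, F) φ x w)
  rw [hφ.inner_mfderiv, hφ.inner_pullbackDeriv_meanCurvature_mfderiv, neg_mul_neg,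
    real_inner_self_eq_norm_sq, real_inner_self_eq_norm_sq, hw, one_pow, mul_one, ← sq] at hcs
  exact hcs

lemma IsIsometricImmersion.le_metricTrace_pullbackDeriv_meanCurvature
    (hφ : IsIsometricImmersion E F φ) (x : M) :
    Module.finrank ℝ E * ‖meanCurvature E F φ x‖ ^ 4 ≤
      metricTrace x fun v w : TangentSpace 𝓘(ℝ, E) x =>
        ⟪pullbackDeriv E φ (meanCurvature E F φ) x v,
          pullbackDeriv E φ (meanCurvature E F φ) x w⟫ := by
  have htrace : (metricTrace x fun v w =>
      ⟪meanCurvature E F φ x, secondFundamentalForm E F φ x v w⟫) =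
      Module.finrank ℝ E * ‖meanCurvature E F φ x‖ ^ 2 := by
    rw [← real_inner_self_eq_norm_sq, ← real_inner_smul_right, finrank_smul_meanCurvature]
    simp only [metricTrace, inner_sum]
  have hderiv : (metricTrace x fun v w =>
      ⟪meanCurvature E F φ x, secondFundamentalForm E F φ x v w⟫ ^ 2) ≤
      metricTrace x fun v w : TangentSpace 𝓘(ℝ, E) x =>
        ⟪pullbackDeriv E φ (meanCurvature E F φ) x v,
          pullbackDeriv E φ (meanCurvature E F φ) x w⟫ := by
    refine Finset.sum_le_sum fun i _ => ?_
    beta_reduce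
    rw [real_inner_self_eq_norm_sq]
    exact hφ.sq_inner_secondFundamentalForm_le _ (OrthonormalBasis.norm_eq_one _ i)
  have hcs := sq_metricTrace_le (x := x)
    fun v w => ⟪meanCurvature E F φ x, secondFundamentalForm E F φ x v w⟫
  rw [htrace] at hcs
  refine le_trans ?_ hderiv
  rcases (Module.finrank ℝ E).eq_zero_or_pos with hm | hm
  · rw [hm, Nat.cast_zero, zero_mul]
    exact Finset.sum_nonneg fun i _ => sq_nonneg _
  · refine le_of_mul_le_mul_left ?_ (Nat.cast_pos (α := ℝ).2 hm)
    calc _ = (Module.finrank ℝ E * ‖meanCurvature E F φ x‖ ^ 2) ^ 2 := by ring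
      _ ≤ _ := hcs

lemma IsBiminimalSubmanifold.le_inner_roughLaplacian {lam : ℝ}
    (hφ : IsBiminimalSubmanifold E F φ lam) (hN : NonposSectionalCurvature F N) (x : M) :
    lam * ‖meanCurvature E F φ x‖ ^ 2 ≤
      ⟪roughLaplacian E φ (meanCurvature E F φ) x, meanCurvature E F φ x⟫ := by
  have hnormal (c : TangentSpace 𝓘(ℝ, E) x) :
      ⟪meanCurvature E F φ x, mfderiv 𝓘(ℝ, E) 𝓘(ℝ, F) φ x c⟫ = 0 :=
    hφ.isometric.inner_meanCurvature_mfderiv c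
  have hcurv : ⟪metricTrace x fun v w => curvature (φ x) (meanCurvature E F φ x)
      (mfderiv 𝓘(ℝ, E) 𝓘(ℝ, F) φ x v) (mfderiv 𝓘(ℝ, E) 𝓘(ℝ, F) φ x w),
      meanCurvature E F φ x⟫ ≤ 0 := by
    rw [metricTrace, sum_inner]
    exact Finset.sum_nonpos fun i _ => hN.inner_curvature_nonpos (hnormal _)
  have hpair := congrArg (⟪·, meanCurvature E F φ x⟫) (hφ.equation x)
  simp only [inner_add_left, inner_normalPart_of_normal _ hnormal, inner_sub_left, inner_neg_left,
    real_inner_smul_left, inner_zero_left, real_inner_self_eq_norm_sq] at hpair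
  linarith

end Biminimal

end RiemGeom

theorem lemma3p4_general {E : Type*} [NormedAddCommGroup E] [NormedSpace ℝ E]
    [FiniteDimensional ℝ E]
    {M : Type*} [TopologicalSpace M] [ChartedSpace E M] [IsManifold 𝓘(ℝ, E) ∞ M]
    [RiemannianBundle (fun x : M => TangentSpace 𝓘(ℝ, E) x)]
    [IsContMDiffRiemannianBundle 𝓘(ℝ, E) ∞ E (fun x : M => TangentSpace 𝓘(ℝ, E) x)]
    {F : Type*} [NormedAddCommGroup F] [NormedSpace ℝ F] [FiniteDimensional ℝ F]
    {N : Type*} [TopologicalSpace N] [ChartedSpace F N] [IsManifold 𝓘(ℝ, F) ∞ N]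
    [RiemannianBundle (fun y : N => TangentSpace 𝓘(ℝ, F) y)]
    [IsContMDiffRiemannianBundle 𝓘(ℝ, F) ∞ F (fun y : N => TangentSpace 𝓘(ℝ, F) y)]
    (hN : RiemGeom.NonposSectionalCurvature F N) {φ : M → N} {lam : ℝ}
    (hφ : RiemGeom.IsBiminimalSubmanifold E F φ lam) (x : M) :
    2 * lam * ‖RiemGeom.meanCurvature E F φ x‖ ^ 2
        + 2 * Module.finrank ℝ E * ‖RiemGeom.meanCurvature E F φ x‖ ^ 4
      ≤ RiemGeom.laplacian E (fun y => ‖RiemGeom.meanCurvature E F φ y‖ ^ 2) x := by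
  have hsmooth := RiemGeom.contDiffAt_coordField_meanCurvature hφ.isometric.contMDiff x
  have hbochner := RiemGeom.laplacian_norm_sq hφ.isometric.contMDiff
    (hsmooth.of_le ENat.LEInfty.out)
  have hequation := hφ.le_inner_roughLaplacian hN x
  have hderiv := hφ.isometric.le_metricTrace_pullbackDeriv_meanCurvature x
  linarith

theorem lemma3p4 {m n : ℕ}
    {M : Type*} [TopologicalSpace M] [ChartedSpace (EuclideanSpace ℝ (Fin m)) M]
    [IsManifold 𝓘(ℝ, EuclideanSpace ℝ (Fin m)) ∞ M]
    [RiemannianBundle (fun x : M => TangentSpace 𝓘(ℝ, EuclideanSpace ℝ (Fin m)) x)]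
    [IsContMDiffRiemannianBundle 𝓘(ℝ, EuclideanSpace ℝ (Fin m)) ∞ (EuclideanSpace ℝ (Fin m))
      (fun x : M => TangentSpace 𝓘(ℝ, EuclideanSpace ℝ (Fin m)) x)]
    {N : Type*} [TopologicalSpace N] [ChartedSpace (EuclideanSpace ℝ (Fin n)) N]
    [IsManifold 𝓘(ℝ, EuclideanSpace ℝ (Fin n)) ∞ N]
    [RiemannianBundle (fun y : N => TangentSpace 𝓘(ℝ, EuclideanSpace ℝ (Fin n)) y)]
    [IsContMDiffRiemannianBundle 𝓘(ℝ, EuclideanSpace ℝ (Fin n)) ∞ (EuclideanSpace ℝ (Fin n))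
      (fun y : N => TangentSpace 𝓘(ℝ, EuclideanSpace ℝ (Fin n)) y)]
    (hN : RiemGeom.NonposSectionalCurvature (EuclideanSpace ℝ (Fin n)) N)
    (φ : M → N) (lam : ℝ) (hlam : 0 ≤ lam)
    (hφ : RiemGeom.IsBiminimalSubmanifold (EuclideanSpace ℝ (Fin m)) (EuclideanSpace ℝ (Fin n))
      φ lam)
    (x : M) :
    RiemGeom.laplacian (EuclideanSpace ℝ (Fin m))
        (fun y => ‖RiemGeom.meanCurvature (EuclideanSpace ℝ (Fin m)) (EuclideanSpace ℝ (Fin n))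
          φ y‖ ^ 2) x
      ≥ 2 * (m : ℝ) * ‖RiemGeom.meanCurvature (EuclideanSpace ℝ (Fin m))
          (EuclideanSpace ℝ (Fin n)) φ x‖ ^ 4 := by
  have h := lemma3p4_general hN hφ x
  rw [finrank_euclideanSpace_fin] at h
  exact le_trans (le_add_of_nonneg_left (by positivity)) h
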